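/- A sequence $a=(a_n)_{n\in\mathbb Z}$ of integers is called bijective if $n\mapsto a_n$ is a bijection $\mathbb Z\to\mathbb Z$. For $\lambda\ge 1$ it satisfies the $\lambda$-three point condition if $\left|\frac{a_n-a_m}{a_n-a_k}\right|\le\lambda$ for all integers $n<m<k$. An integer interval $I=\{k,k+1,\dots,\ell\}$ with $k\le \ell$ splits $a$ if $a_n>\max_{j\in I}a_j$ for all $n>\ell$ and $a_n<\min_{j\in I}a_j$ for all $n<k$. For a real $C\ge 1$, a bijective sequence $a$ is $C$-splittable if there is a strictly increasing sequence of integers $(k_n)_{n\in\mathbb Z}$ such that, for every $n\in\mathbb Z$, the interval $\{k_n+1,\dots,k_{n+1}\}$ splits $a$ and $k_{n+1}-k_n\le C$. For $K\ge 1$, an orientation preserving homeomorphism $f$ of $\mathbb C$ onto $\mathbb C$ is $K$-quasiconformal if its distributional derivatives $f_z$ and $f_{\bar z}$ are locally integrable functions and $|f_{\bar z}|<|f_z|$, $\frac{|f_z|+|f_{\bar z}|}{|f_z|-|f_{\bar z}|}\le K$ almost everywhere. **Theorem.** For every real $\lambda\ge 1$ and every $\delta\in(0,+\infty]$ there is a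 constant $K=K(\lambda,\delta)$, depending only on $\lambda$ and $\delta$, such that the following holds. Let $(a_n)_{n\in\mathbb Z}$ be a bijective sequence of integers that satisfies the $\lambda$-three point condition, with $a_n\to+\infty$ as $n\to+\infty$ and $a_n\to-\infty$ as $n\to-\infty$. Then there is a $K$-quasiconformal homeomorphism $f:\mathbb C\to\mathbb C$ such that 1. $f(z)=z$ for all $z\in\mathbb C\setminus\{z:|\operatorname{Im}z|<\delta\}$; 2. the numbers $b_n:=f(a_n)$, $n\in\mathbb Z$, are integers, and $(b_n)_{n\in\mathbb Z}$ is a bijective sequence that is $(2\lambda+3)$-splittable. -/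

import Mathlib

open Filter MeasureTheory
open scoped ENNReal ContDiff

/-- The integer interval `[k, l]` (with `k ≤ l`) splits the sequence `a`: every later term is larger
than all terms with index in `[k, l]`, and every earlier term is smaller than all of them. -/
def Splits (a : ℤ → ℤ) (k l : ℤ) : Prop :=
  k ≤ l ∧
  (∀ n, l < n → ∀ j ∈ Set.Icc k l, a j < a n) ∧
  (∀ n, n < k → ∀ j ∈ Set.Icc k l, a n < a j)

/-- A bijective sequence `a` is `C`-splittable: the integers are cut into consecutive intervals
`[k n + 1, k (n + 1)]` of length at most `C`, each of which splits `a`. -/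
def IsSplittable (C : ℝ) (a : ℤ → ℤ) : Prop :=
  Function.Bijective a ∧
  ∃ k : ℤ → ℤ, StrictMono k ∧
    ∀ n, Splits a (k n + 1) (k (n + 1)) ∧ ((k (n + 1) - k n : ℤ) : ℝ) ≤ C

/-- The `lam`-three point condition. -/
def ThreePointCondition (lam : ℝ) (a : ℤ → ℤ) : Prop :=
  ∀ n m k : ℤ, n < m → m < k →
    |((a n : ℝ) - (a m : ℝ)) / ((a n : ℝ) - (a k : ℝ))| ≤ lam

/-- `∂φ/∂z = (φ_x - i φ_y) / 2` for a real-valued function `φ` on the plane. -/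
noncomputable def dz (φ : ℂ → ℝ) (z : ℂ) : ℂ :=
  ((fderiv ℝ φ z 1 : ℂ) - Complex.I * (fderiv ℝ φ z Complex.I : ℂ)) / 2

/-- `∂φ/∂z̄ = (φ_x + i φ_y) / 2` for a real-valued function `φ` on the plane. -/
noncomputable def dzbar (φ : ℂ → ℝ) (z : ℂ) : ℂ :=
  ((fderiv ℝ φ z 1 : ℂ) + Complex.I * (fderiv ℝ φ z Complex.I : ℂ)) / 2

/-- The locally integrable function `g` is the distributional derivative `f_z` of `f`. -/
def HasDistribDz (f g : ℂ → ℂ) : Prop :=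
  LocallyIntegrable g ∧
  ∀ φ : ℂ → ℝ, ContDiff ℝ ∞ φ → HasCompactSupport φ →
    ∫ z, (φ z : ℂ) * g z = - ∫ z, dz φ z * f z

/-- The locally integrable function `g` is the distributional derivative `f_{z̄}` of `f`. -/
def HasDistribDzbar (f g : ℂ → ℂ) : Prop :=
  LocallyIntegrable g ∧
  ∀ φ : ℂ → ℝ, ContDiff ℝ ∞ φ → HasCompactSupport φ →
    ∫ z, (φ z : ℂ) * g z = - ∫ z, dzbar φ z * f z

/-- A homeomorphism of the plane preserves orientation: for every circle `t ↦ z + r e^{it}`, the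
image curve winds exactly once, counterclockwise, around `f z`, that is, a continuous logarithm `L`
of `t ↦ f (z + r e^{it}) - f z` increases by `2πi` over `[0, 2π]`. -/
def OrientationPreserving (f : ℂ ≃ₜ ℂ) : Prop :=
  ∀ (z : ℂ) (r : ℝ), 0 < r → ∃ L : ℝ → ℂ, Continuous L ∧
    (∀ t : ℝ, Complex.exp (L t) = f (z + r * Complex.exp (t * Complex.I)) - f z) ∧
    L (2 * Real.pi) = L 0 + 2 * Real.pi * Complex.I

/-- `f : ℂ → ℂ` is a `K`-quasiconformal homeomorphism (analytic definition): it preserves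
orientation, its distributional derivatives `f_z`, `f_{z̄}` are locally integrable functions, and the
essential supremum of `(|f_z| + |f_{z̄}|) / (|f_z| - |f_{z̄}|)` is at most `K`, the denominator
being positive almost everywhere. -/
def IsQuasiconformal (K : ℝ) (f : ℂ ≃ₜ ℂ) : Prop :=
  1 ≤ K ∧ OrientationPreserving f ∧
  ∃ fz fzbar : ℂ → ℂ, HasDistribDz f fz ∧ HasDistribDzbar f fzbar ∧
    ∀ᵐ z, ‖fzbar z‖ < ‖fz z‖ ∧
      (‖fz z‖ + ‖fzbar z‖) / (‖fz z‖ - ‖fzbar z‖) ≤ K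

/-! The three point condition forces `a n = n + a 0` up to an error of `2λ + 1`. Two consecutive
integers whose indices straddle `n` differ by 1, so both lie near `a n`; hence no earlier term
exceeds `a n` by more than `λ` and no later term falls more than `λ` below it. Counting the values
taken on `(n, m]` then gives `ThreePointCondition.abs_sub_sub_le`.

Thus `a n ↦ n + a 0` is a permutation of the integers with bounded displacement, and
`exists_isQuasiconformal_of_bounded_displacement` extends it to the plane in three moves: lift each
integer `k` to a height proportional to `σ k - k`, apply a shear whose speed is proportional to the
height, and lower the points again. Each move is smooth and bi-Lipschitz with constants independent
of `σ`, and the identity off the strip. The image sequence `n + a 0` is split by singletons.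

Quasiconformality comes from `isQuasiconformal_of_biLipschitz`: a bi-Lipschitz constant `M` bounds
the dilatation by `M ^ 2`, and being the identity on a half-plane fixes the orientation. -/

/-! ### Winding numbers and orientation -/

/-- Two continuous logarithms of the same function that agree at one point agree everywhere. -/
theorem continuous_log_unique {X : Type*} [TopologicalSpace X] [PreconnectedSpace X] {g₁ g₂ : X → ℂ}
    (h₁ : Continuous g₁) (h₂ : Continuous g₂) (h : ∀ t, Complex.exp (g₁ t) = Complex.exp (g₂ t))
    (a : X) (ha : g₁ a = g₂ a) : g₁ = g₂ :=
  Complex.isCoveringMap_exp.eq_of_comp_eq h₁ h₂ (funext fun t ↦ Subtype.ext (h t)) a ha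

/-- A nowhere vanishing continuous function on the plane has a continuous logarithm. -/
theorem exists_continuous_log (H : ℝ × ℝ → ℂ) (hH : Continuous H) (h0 : ∀ p, H p ≠ 0) :
    ∃ F : ℝ × ℝ → ℂ, Continuous F ∧ ∀ p, Complex.exp (F p) = H p := by
  obtain ⟨F, ⟨-, hF⟩, -⟩ := Complex.isCoveringMapOn_exp.existsUnique_continuousMap_lifts
    (A := ℝ × ℝ) ⟨H, hH⟩ (a₀ := 0) (e₀ := Complex.log (H 0))
    (by simpa using Complex.exp_log (h0 0)) (fun p ↦ h0 p)
  exact ⟨F, F.continuous, fun p ↦ congr_fun hF p⟩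

/-- A homeomorphism of the plane that is the identity on a half-plane preserves orientation. -/
theorem orientationPreserving_of_eq_id (f : ℂ ≃ₜ ℂ) (hf : ∀ z : ℂ, 1 ≤ z.im → f z = z) :
    OrientationPreserving f := by
  intro z r hr
  -- Slide the circle up while rescaling its radius to 1. The height `Y` puts the final unit circle
  -- inside `1 ≤ Im`, where `f` is the identity; the radius is interpolated geometrically so that it
  -- never vanishes.
  set Y : ℝ := |z.im| + 2 with hY
  set c : ℝ → ℂ := fun s ↦ z + s * Y * Complex.I with hc
  set ρ : ℝ → ℝ := fun s ↦ Real.exp ((1 - s) * Real.log r) with hρ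
  set e : ℝ → ℂ := fun t ↦ Complex.exp (t * Complex.I) with he
  have hf_cont := f.continuous
  obtain ⟨F, hF, hexp⟩ := exists_continuous_log
    (fun p ↦ f (c p.1 + ρ p.1 * e p.2) - f (c p.1)) (by fun_prop) (by
      intro p h
      have := f.injective (sub_eq_zero.1 h)
      have h2 : (ρ p.1 : ℂ) * e p.2 = 0 := by simpa using this
      rcases mul_eq_zero.1 h2 with h3 | h3
      · exact (Real.exp_pos _).ne' (Complex.ofReal_eq_zero.1 h3)
      · exact Complex.exp_ne_zero _ h3)
  have hone : ∀ t, Complex.exp (F (1, t)) = e t := by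
    intro t
    have hYz : -z.im ≤ |z.im| := neg_le_abs _
    have h1 : f (c 1) = c 1 := hf _ (by simp [hc, hY]; linarith)
    have h2 : f (c 1 + e t) = c 1 + e t := hf _ (by
      have : -1 ≤ (e t).im := by
        simp only [he, Complex.exp_ofReal_mul_I_im]; exact Real.neg_one_le_sin t
      simp [hc, hY]; linarith)
    rw [hexp]
    simp [hρ, h1, h2]
  have hperiod : ∀ t, e (t + 2 * Real.pi) = e t := by
    intro t
    simp only [he]
    push_cast
    rw [add_mul, Complex.exp_add, Complex.exp_two_pi_mul_I, mul_one]
  have hlin : (fun t : ℝ ↦ F (1, t)) = fun t : ℝ ↦ t * Complex.I + F (1, 0) := by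
    refine continuous_log_unique (by fun_prop) (by fun_prop) (fun t ↦ ?_) 0 (by simp)
    rw [hone, Complex.exp_add, hone]
    simp [he]
  -- Homotopy invariance of the winding number: both sides are logarithms of the same function of
  -- `s`, and they agree at `s = 1`.
  have hconst : (fun s : ℝ ↦ F (s, 2 * Real.pi)) =
      fun s : ℝ ↦ F (s, 0) + 2 * Real.pi * Complex.I := by
    refine continuous_log_unique (by fun_prop) (by fun_prop) (fun s ↦ ?_) 1 ?_
    · rw [hexp, Complex.exp_add, hexp, Complex.exp_two_pi_mul_I, mul_one]
      have := hperiod 0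
      rw [zero_add] at this
      simp only [this]
    · have := congr_fun hlin (2 * Real.pi)
      rw [this]
      push_cast
      ring
  refine ⟨fun t ↦ F (0, t), by fun_prop, fun t ↦ ?_, congr_fun hconst 0⟩
  rw [hexp]
  simp [hc, hρ, he, Real.exp_log hr]

/-! ### Dilatation and weak derivatives of bi-Lipschitz maps -/

theorem HasFDerivAt.norm_le_mul_of_expanding {E F : Type*} [NormedAddCommGroup E] [NormedSpace ℝ E]
    [NormedAddCommGroup F] [NormedSpace ℝ F] {f : E → F} {A : E →L[ℝ] F} {x : E} {M : ℝ}
    (hA : HasFDerivAt f A x) (h : ∀ y z, ‖y - z‖ ≤ M * ‖f y - f z‖) (v : E) :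
    ‖v‖ ≤ M * ‖A v‖ := by
  have h1 := (hA.hasLineDerivAt v).tendsto_slope_zero
  refine ge_of_tendsto (h1.norm.const_mul M) ?_
  filter_upwards [self_mem_nhdsWithin] with t ht
  have ht0 : 0 < |t| := abs_pos.2 ht
  have h2 := h (x + t • v) x
  rw [add_sub_cancel_left, norm_smul, Real.norm_eq_abs] at h2
  rw [norm_smul, norm_inv, Real.norm_eq_abs]
  calc ‖v‖ = |t|⁻¹ * (|t| * ‖v‖) := by field_simp
    _ ≤ |t|⁻¹ * (M * ‖f (x + t • v) - f x‖) := by gcongr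
    _ = _ := by ring

/-- The complex linear and antilinear parts of a real linear map of the plane control its
dilatation. -/
theorem exists_unit_norm_apply_eq (A : ℂ →L[ℝ] ℂ) :
    ∃ v w : ℂ, ‖v‖ = 1 ∧ ‖w‖ = 1 ∧
      ‖A v‖ = ‖(A 1 - Complex.I * A Complex.I) / 2‖ + ‖(A 1 + Complex.I * A Complex.I) / 2‖ ∧
      ‖A w‖ = |‖(A 1 - Complex.I * A Complex.I) / 2‖ - ‖(A 1 + Complex.I * A Complex.I) / 2‖| := by
  set α := (A 1 - Complex.I * A Complex.I) / 2 with hα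
  set β := (A 1 + Complex.I * A Complex.I) / 2 with hβ
  have hA : ∀ v : ℂ, A v = α * v + β * (starRingEnd ℂ) v := by
    intro v
    have h1 : A v = v.re * A 1 + v.im * A Complex.I := by
      conv_lhs => rw [← Complex.re_add_im v]
      have e1 : ((v.re : ℂ) + v.im * Complex.I) = v.re • (1 : ℂ) + v.im • Complex.I := by simp
      rw [e1, map_add, map_smul, map_smul]; simp
    rw [h1, hα, hβ]
    have h2 : v = v.re + v.im * Complex.I := (Complex.re_add_im v).symm
    have h3 : (starRingEnd ℂ) v = v.re - v.im * Complex.I := by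
      apply Complex.ext <;> simp
    rw [h3]
    conv_rhs => rw [h2]
    simp only [Complex.add_re, Complex.ofReal_re, Complex.mul_re, Complex.I_re, mul_zero,
      Complex.ofReal_im, Complex.I_im, Complex.add_im, Complex.mul_im, mul_one, zero_add, sub_self,
      add_zero]
    linear_combination ((v.im : ℂ) * A Complex.I) * Complex.I_sq
  -- At angle `τ` the terms `α v` and `β v̄` share the argument `σ`, so their norms add; multiplying
  -- `v` by `i` makes them opposite.
  set τ : ℂ := (((β.arg - α.arg) / 2 : ℝ) : ℂ) with hτ
  set σ : ℂ := (((α.arg + β.arg) / 2 : ℝ) : ℂ) with hσ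
  have hu : ‖Complex.exp (σ * Complex.I)‖ = 1 := Complex.norm_exp_ofReal_mul_I _
  have hv : ‖Complex.exp (τ * Complex.I)‖ = 1 := Complex.norm_exp_ofReal_mul_I _
  have hconj : (starRingEnd ℂ) (Complex.exp (τ * Complex.I)) = Complex.exp (-(τ * Complex.I)) := by
    rw [← Complex.exp_conj, map_mul, hτ, Complex.conj_ofReal, Complex.conj_I, mul_neg]
  have h1 : α * Complex.exp (τ * Complex.I) = ‖α‖ * Complex.exp (σ * Complex.I) := by
    conv_lhs => rw [← Complex.norm_mul_exp_arg_mul_I α]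
    rw [mul_assoc, ← Complex.exp_add]
    congr 2
    rw [hτ, hσ]; push_cast; ring
  have h2 : β * Complex.exp (-(τ * Complex.I)) = ‖β‖ * Complex.exp (σ * Complex.I) := by
    conv_lhs => rw [← Complex.norm_mul_exp_arg_mul_I β]
    rw [mul_assoc, ← Complex.exp_add]
    congr 2
    rw [hτ, hσ]; push_cast; ring
  refine ⟨Complex.exp (τ * Complex.I), Complex.I * Complex.exp (τ * Complex.I), hv, by simp [hv],
    ?_, ?_⟩
  · rw [hA, hconj, h1, h2, ← add_mul, norm_mul, hu, mul_one, ← Complex.ofReal_add,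
      Complex.norm_real, Real.norm_of_nonneg (by positivity)]
  · have : A (Complex.I * Complex.exp (τ * Complex.I)) =
        Complex.I * (((‖α‖ - ‖β‖ : ℝ) : ℂ) * Complex.exp (σ * Complex.I)) := by
      rw [hA, map_mul, hconj, Complex.conj_I]
      push_cast
      linear_combination Complex.I * h1 - Complex.I * h2
    rw [this, norm_mul, norm_mul, hu, Complex.norm_I, Complex.norm_real, one_mul, mul_one,
      Real.norm_eq_abs]

theorem integral_mul_fderiv_eq_neg_of_contDiff {f : ℂ → ℂ} (hf : ContDiff ℝ 1 f) {φ : ℂ → ℝ}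
    (hφ : ContDiff ℝ ∞ φ) (hs : HasCompactSupport φ) (v : ℂ) :
    ∫ z, (φ z : ℂ) * fderiv ℝ f z v = - ∫ z, (fderiv ℝ φ z v : ℂ) * f z := by
  have hd : ∀ z, HasFDerivAt (fun z ↦ (φ z : ℂ)) (Complex.ofRealCLM.comp (fderiv ℝ φ z)) z :=
    fun z ↦ Complex.ofRealCLM.hasFDerivAt.comp z
      (hφ.differentiable (by simp) z).hasFDerivAt
  have hfd : ∀ z, fderiv ℝ (fun z ↦ (φ z : ℂ)) z v = (fderiv ℝ φ z v : ℂ) := by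
    intro z; rw [(hd z).fderiv]; rfl
  have hsC : HasCompactSupport fun z ↦ (φ z : ℂ) := hs.comp_left (g := Complex.ofReal) rfl
  have hφc := hφ.continuous
  have hfc := hf.continuous
  have hf'c : Continuous fun z ↦ fderiv ℝ f z v :=
    (hf.continuous_fderiv one_ne_zero).clm_apply continuous_const
  have hφ'c : Continuous fun z ↦ (fderiv ℝ φ z v : ℂ) :=
    Complex.continuous_ofReal.comp
      ((hφ.continuous_fderiv (by simp)).clm_apply continuous_const)
  have hφ's : HasCompactSupport fun z ↦ (fderiv ℝ φ z v : ℂ) :=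
    (hs.fderiv_apply ℝ v).comp_left (g := Complex.ofReal) rfl
  have := integral_mul_fderiv_eq_neg_fderiv_mul_of_integrable (μ := (volume : Measure ℂ))
    (f := fun z ↦ (φ z : ℂ)) (g := f) (v := v) ?_ ?_ ?_
    (fun z _ ↦ (hd z).differentiableAt) (fun z _ ↦ hf.differentiable one_ne_zero z)
  · simpa only [hfd] using this
  · simp only [hfd]
    exact (hφ'c.mul hfc).integrable_of_hasCompactSupport hφ's.mul_right
  · exact ((Complex.continuous_ofReal.comp hφc).mul hf'c).integrable_of_hasCompactSupport
      hsC.mul_right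
  · exact ((Complex.continuous_ofReal.comp hφc).mul hfc).integrable_of_hasCompactSupport
      hsC.mul_right

theorem integrable_ofReal_mul_of_hasCompactSupport {φ : ℂ → ℝ} {g : ℂ → ℂ} (hφ : Continuous φ)
    (hs : HasCompactSupport φ) (hg : Continuous g) : Integrable fun z ↦ (φ z : ℂ) * g z :=
  ((Complex.continuous_ofReal.comp hφ).mul hg).integrable_of_hasCompactSupport
    (hs.comp_left (g := Complex.ofReal) rfl).mul_right

/-- Stated with a free `c` so that `c = -i` and `c = i` give the two Wirtinger derivatives. -/
theorem integral_mul_wirtinger_eq_neg {f : ℂ → ℂ} (hf : ContDiff ℝ 1 f) {φ : ℂ → ℝ}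
    (hφ : ContDiff ℝ ∞ φ) (hs : HasCompactSupport φ) (c : ℂ) :
    ∫ z, (φ z : ℂ) * ((fderiv ℝ f z 1 + c * fderiv ℝ f z Complex.I) / 2) =
      - ∫ z, (((fderiv ℝ φ z 1 : ℂ) + c * (fderiv ℝ φ z Complex.I : ℂ)) / 2) * f z := by
  have hf' : ∀ v, Continuous fun z ↦ fderiv ℝ f z v := fun v ↦
    (hf.continuous_fderiv one_ne_zero).clm_apply continuous_const
  have hφ' : ∀ v, Continuous fun z ↦ fderiv ℝ φ z v := fun v ↦
    (hφ.continuous_fderiv (by simp)).clm_apply continuous_const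
  have i1 := fun v ↦ integrable_ofReal_mul_of_hasCompactSupport hφ.continuous hs (hf' v)
  have i2 := fun v ↦ integrable_ofReal_mul_of_hasCompactSupport (hφ' v) (hs.fderiv_apply ℝ v)
    hf.continuous
  have e1 : ∀ z, (φ z : ℂ) * ((fderiv ℝ f z 1 + c * fderiv ℝ f z Complex.I) / 2) =
      (1 / 2 : ℂ) * ((φ z : ℂ) * fderiv ℝ f z 1) +
        (c / 2) * ((φ z : ℂ) * fderiv ℝ f z Complex.I) := fun z ↦ by ring
  have e2 : ∀ z, (((fderiv ℝ φ z 1 : ℂ) + c * (fderiv ℝ φ z Complex.I : ℂ)) / 2) * f z =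
      (1 / 2 : ℂ) * ((fderiv ℝ φ z 1 : ℂ) * f z) +
        (c / 2) * ((fderiv ℝ φ z Complex.I : ℂ) * f z) := fun z ↦ by ring
  simp_rw [e1, e2]
  rw [integral_add ((i1 1).const_mul _) ((i1 _).const_mul _),
    integral_add ((i2 1).const_mul _) ((i2 _).const_mul _)]
  simp only [integral_const_mul, integral_mul_fderiv_eq_neg_of_contDiff hf hφ hs]
  ring

/-- A bi-Lipschitz `C¹` homeomorphism that is the identity on a half-plane is quasiconformal. -/
theorem isQuasiconformal_of_biLipschitz (f : ℂ ≃ₜ ℂ) (hf : ContDiff ℝ 1 f) {M : ℝ} (hM : 1 ≤ M)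
    (hlip : ∀ y z, ‖f y - f z‖ ≤ M * ‖y - z‖) (hexp : ∀ y z, ‖y - z‖ ≤ M * ‖f y - f z‖)
    (hid : ∀ z : ℂ, 1 ≤ z.im → f z = z) : IsQuasiconformal (M ^ 2) f := by
  have hf' : ∀ v, Continuous fun z ↦ fderiv ℝ f z v := fun v ↦
    (hf.continuous_fderiv one_ne_zero).clm_apply continuous_const
  have hd : ∀ z, HasFDerivAt f (fderiv ℝ f z) z := fun z ↦
    (hf.differentiable one_ne_zero z).hasFDerivAt
  have hub : ∀ z, ‖fderiv ℝ f z‖ ≤ M := fun z ↦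
    (hd z).le_of_lip' (by linarith) (Eventually.of_forall fun x ↦ hlip x z)
  have hlb : ∀ z v, ‖v‖ ≤ M * ‖fderiv ℝ f z v‖ := fun z v ↦
    (hd z).norm_le_mul_of_expanding hexp v
  set α : ℂ → ℂ := fun z ↦ (fderiv ℝ f z 1 - Complex.I * fderiv ℝ f z Complex.I) / 2 with hα
  set β : ℂ → ℂ := fun z ↦ (fderiv ℝ f z 1 + Complex.I * fderiv ℝ f z Complex.I) / 2 with hβ
  have hαc : Continuous α := ((hf' _).sub (continuous_const.mul (hf' _))).div_const _
  have hβc : Continuous β := ((hf' _).add (continuous_const.mul (hf' _))).div_const _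
  have hsum : ∀ z, ‖α z‖ + ‖β z‖ ≤ M := by
    intro z
    obtain ⟨v, -, hv, -, h1, -⟩ := exists_unit_norm_apply_eq (fderiv ℝ f z)
    rw [← h1]
    simpa [hv] using (fderiv ℝ f z).le_of_opNorm_le (hub z) v
  have hdiff : ∀ z, 1 ≤ M * |‖α z‖ - ‖β z‖| := by
    intro z
    obtain ⟨-, w, -, hw, -, h1⟩ := exists_unit_norm_apply_eq (fderiv ℝ f z)
    rw [← h1, ← hw]
    exact hlb z w
  have hcont : Continuous fun z ↦ ‖α z‖ - ‖β z‖ := hαc.norm.sub hβc.norm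
  have hne : ∀ z, ‖α z‖ - ‖β z‖ ≠ 0 := by
    intro z h
    have := hdiff z
    rw [h, abs_zero, mul_zero] at this
    linarith
  have htop : 0 < ‖α (2 * Complex.I)‖ - ‖β (2 * Complex.I)‖ := by
    have hev : f =ᶠ[nhds (2 * Complex.I)] id := by
      have : {z : ℂ | 1 < z.im} ∈ nhds (2 * Complex.I) :=
        (isOpen_lt continuous_const Complex.continuous_im).mem_nhds (by simp)
      filter_upwards [this] with z hz using hid z (le_of_lt hz)
    simp [hα, hβ, hev.fderiv_eq]
  -- The difference is continuous, vanishes nowhere and is positive at `2i`, so by connectedness it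
  -- is positive everywhere.
  have hpos : ∀ z, 0 < ‖α z‖ - ‖β z‖ := by
    intro z
    by_contra! hz
    obtain ⟨w, hw⟩ := mem_range_of_exists_le_of_exists_ge hcont ⟨z, hz⟩ ⟨_, htop.le⟩
    exact hne w hw
  refine ⟨by nlinarith, orientationPreserving_of_eq_id f hid, α, β,
    ⟨hαc.locallyIntegrable, fun φ hφ hs ↦ ?_⟩, ⟨hβc.locallyIntegrable, fun φ hφ hs ↦ ?_⟩,
    Eventually.of_forall fun z ↦ ⟨by linarith [hpos z], ?_⟩⟩
  · have := integral_mul_wirtinger_eq_neg hf hφ hs (-Complex.I)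
    simp only [neg_mul, ← sub_eq_add_neg] at this
    exact this
  · exact integral_mul_wirtinger_eq_neg hf hφ hs Complex.I
  · have h1 := hdiff z
    rw [abs_of_pos (hpos z)] at h1
    rw [div_le_iff₀ (hpos z)]
    nlinarith [hsum z]

/-! ### Growth of sequences with the three point condition -/

/-- If the indices of two consecutive integers straddle `n`, then `a n` is close to these integers. -/
theorem ThreePointCondition.abs_sub_le_of_adjacent {lam : ℝ} {a : ℤ → ℤ} (hlam : 1 ≤ lam)
    (ha : ThreePointCondition lam a) {p n q : ℤ} (hp : p ≤ n) (hq : n < q)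
    (h : |a p - a q| = 1) : |(a n : ℝ) - a p| ≤ lam := by
  have h' : |(a p : ℝ) - a q| = 1 := by exact_mod_cast h
  rcases hp.eq_or_lt with rfl | hp
  · simpa using le_trans zero_le_one hlam
  · have := ha p n q hp hq
    rwa [abs_div, h', div_one, abs_sub_comm] at this

theorem bddAbove_image_Iic {a : ℤ → ℤ} (hbot : Tendsto a atBot atBot) (n : ℤ) :
    BddAbove (a '' Set.Iic n) := by
  obtain ⟨N, hN⟩ := eventually_atBot.1 (hbot.eventually_le_atBot 0)
  have h1 : BddAbove (a '' Set.Icc N n) := ((Set.finite_Icc N n).image a).bddAbove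
  refine (h1.union (bddAbove_Iic (a := (0 : ℤ)))).mono ?_
  rintro _ ⟨j, hj, rfl⟩
  rcases le_total j N with h | h
  · exact Or.inr (hN j h)
  · exact Or.inl ⟨j, ⟨h, hj⟩, rfl⟩

theorem bddBelow_image_Ioi {a : ℤ → ℤ} (htop : Tendsto a atTop atTop) (n : ℤ) :
    BddBelow (a '' Set.Ioi n) := by
  obtain ⟨N, hN⟩ := eventually_atTop.1 (htop.eventually_ge_atTop 0)
  have h1 : BddBelow (a '' Set.Icc n N) := ((Set.finite_Icc n N).image a).bddBelow
  refine (h1.union (bddBelow_Ici (a := (0 : ℤ)))).mono ?_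
  rintro _ ⟨j, hj, rfl⟩
  rcases le_total N j with h | h
  · exact Or.inr (hN j h)
  · exact Or.inl ⟨j, ⟨le_of_lt hj, h⟩, rfl⟩

section Displacement

variable {lam : ℝ} {a : ℤ → ℤ}

/-- All earlier terms are at most `lam` above `a n`. -/
theorem ThreePointCondition.le_add_of_le (hlam : 1 ≤ lam) (ha : ThreePointCondition lam a)
    (hb : Function.Bijective a) (hbot : Tendsto a atBot atBot) {j n : ℤ} (hj : j ≤ n) :
    (a j : ℝ) ≤ a n + lam := by
  -- Take the largest value `a p` with index at most `n`: by maximality `a p + 1` has an index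
  -- beyond `n`, so this adjacent pair straddles `n`.
  obtain ⟨m, ⟨⟨p, hp, rfl⟩, hm⟩⟩ := Int.exists_greatest_of_bdd (P := (· ∈ a '' Set.Iic n))
    (by obtain ⟨B, hB⟩ := bddAbove_image_Iic hbot n; exact ⟨B, fun z hz ↦ hB hz⟩)
    ⟨_, j, hj, rfl⟩
  obtain ⟨q, hq⟩ := hb.2 (a p + 1)
  have hnq : n < q := by
    by_contra! h
    have := hm (a q) ⟨q, h, rfl⟩
    omega
  have h1 := ha.abs_sub_le_of_adjacent hlam hp hnq (by rw [hq]; simp)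
  have h2 : (a j : ℝ) ≤ a p := by exact_mod_cast hm (a j) ⟨j, hj, rfl⟩
  linarith [(abs_le.1 h1).1]

/-- All later terms are at most `lam` below `a n`. -/
theorem ThreePointCondition.sub_le_of_lt (hlam : 1 ≤ lam) (ha : ThreePointCondition lam a)
    (hb : Function.Bijective a) (htop : Tendsto a atTop atTop) {j n : ℤ} (hj : n < j) :
    (a n : ℝ) ≤ a j + lam := by
  obtain ⟨m, ⟨⟨q, hq, rfl⟩, hm⟩⟩ := Int.exists_least_of_bdd (P := (· ∈ a '' Set.Ioi n))
    (by obtain ⟨B, hB⟩ := bddBelow_image_Ioi htop n; exact ⟨B, fun z hz ↦ hB hz⟩)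
    ⟨_, j, hj, rfl⟩
  obtain ⟨p, hp⟩ := hb.2 (a q - 1)
  have hpn : p ≤ n := by
    by_contra! h
    have := hm (a p) ⟨p, h, rfl⟩
    omega
  have h1 := ha.abs_sub_le_of_adjacent hlam hpn hq (by rw [hp]; simp)
  have h2 : (a q : ℝ) ≤ a j := by exact_mod_cast hm (a j) ⟨j, hj, rfl⟩
  have h3 : (a p : ℝ) + 1 = a q := by rw [hp]; push_cast; ring
  linarith [(abs_le.1 h1).2]

/-- A bijective sequence satisfying the three point condition grows at unit speed, up to a bounded
error. -/
theorem ThreePointCondition.abs_sub_sub_le (hlam : 1 ≤ lam) (ha : ThreePointCondition lam a)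
    (hb : Function.Bijective a) (htop : Tendsto a atTop atTop) (hbot : Tendsto a atBot atBot)
    {n m : ℤ} (hnm : n ≤ m) : |((a m : ℝ) - a n) - (m - n)| ≤ 2 * lam + 1 := by
  -- The `m - n` values in `F` lie in an interval slightly longer than `[a n, a m]` and fill a
  -- slightly shorter one.
  set F := (Finset.Ioc n m).image a with hF
  have hcard : (F.card : ℝ) = m - n := by
    rw [hF, Finset.card_image_of_injective _ hb.1, Int.card_Ioc]
    have : ((m - n).toNat : ℤ) = m - n := Int.toNat_of_nonneg (by omega)
    exact_mod_cast this
  set l := ⌊lam⌋ with hl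
  have hl1 : (l : ℝ) ≤ lam := Int.floor_le _
  have hge : ∀ {x y : ℤ}, (x : ℝ) ≤ y + lam → x ≤ y + l := by
    intro x y h
    have : x - y ≤ l := Int.le_floor.2 (by push_cast; linarith)
    omega
  have hup : F ⊆ Finset.Icc (a n - l) (a m + l) := by
    intro x hx
    obtain ⟨j, hj, rfl⟩ := Finset.mem_image.1 hx
    rw [Finset.mem_Ioc] at hj
    have h1 := hge (ha.sub_le_of_lt hlam hb htop hj.1)
    have h2 := hge (ha.le_add_of_le hlam hb hbot hj.2)
    exact Finset.mem_Icc.2 ⟨by omega, by omega⟩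
  have hdown : Finset.Ioo (a n + l) (a m - l) ⊆ F := by
    intro x hx
    rw [Finset.mem_Ioo] at hx
    obtain ⟨j, rfl⟩ := hb.2 x
    refine Finset.mem_image.2 ⟨j, Finset.mem_Ioc.2 ⟨?_, ?_⟩, rfl⟩
    · by_contra! h
      have := hge (ha.le_add_of_le hlam hb hbot h)
      omega
    · by_contra! h
      have := hge (ha.sub_le_of_lt hlam hb htop h)
      omega
  have h1 := Finset.card_le_card hup
  have h2 := Finset.card_le_card hdown
  rw [Int.card_Icc] at h1
  rw [Int.card_Ioo] at h2
  have hl0 : 1 ≤ l := Int.le_floor.2 (by simpa using hlam)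
  -- Keeps the truncated subtraction in the cardinality of the larger interval from being active.
  have hx : a n - a m ≤ l := by
    rcases hnm.eq_or_lt with rfl | h
    · omega
    · have := hge (ha.sub_le_of_lt hlam hb htop h); omega
  have h3 : (F.card : ℤ) ≤ a m - a n + 2 * l + 1 := by omega
  have h4 : a m - a n - 2 * l - 1 ≤ (F.card : ℤ) := by omega
  have h3' : (F.card : ℝ) ≤ a m - a n + 2 * l + 1 := by exact_mod_cast h3
  have h4' : (a m : ℝ) - a n - 2 * l - 1 ≤ F.card := by exact_mod_cast h4
  rw [abs_le]
  constructor <;> linarith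

end Displacement

/-! ### Extending permutations of bounded displacement -/

theorem exists_lipschitz_const_of_hasCompactSupport {χ : ℝ → ℝ} (h : ContDiff ℝ ∞ χ)
    (hs : HasCompactSupport χ) : ∃ C : ℝ, 0 ≤ C ∧ ∀ x y, |χ x - χ y| ≤ C * |x - y| := by
  obtain ⟨C, hC⟩ := h.lipschitzWith_of_hasCompactSupport hs (by simp)
  exact ⟨C, C.2, fun x y ↦ by simpa [Real.dist_eq] using hC.dist_le_mul x y⟩

/-- Smooth interpolation of a bounded sequence, with a Lipschitz constant proportional to the
bound. -/
theorem exists_smooth_interpolation : ∃ C : ℝ, 0 ≤ C ∧ ∀ (u : ℤ → ℝ) (B : ℝ), (∀ k, |u k| ≤ B) →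
    ∃ φ : ℝ → ℝ, ContDiff ℝ ∞ φ ∧ (∀ x, |φ x| ≤ B) ∧ (∀ x y, |φ x - φ y| ≤ B * C * |x - y|) ∧
      ∀ k : ℤ, φ k = u k := by
  let ρ : ContDiffBump (0 : ℝ) := ⟨1 / 4, 1 / 3, by norm_num, by norm_num⟩
  have hρ : ContDiff ℝ ∞ ρ := ρ.contDiff
  obtain ⟨C, hC0, hC⟩ := exists_lipschitz_const_of_hasCompactSupport hρ ρ.hasCompactSupport
  refine ⟨C, hC0, fun u B hu ↦ ?_⟩
  have hB : 0 ≤ B := (abs_nonneg _).trans (hu 0)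
  set φ : ℝ → ℝ := fun x ↦ u (round x) * ρ (x - round x) with hφ
  have hzero : ∀ x : ℝ, 1 / 3 ≤ |x| → ρ x = 0 := fun x hx ↦
    ρ.zero_of_le_dist (by simpa [Real.dist_eq, ρ] using hx)
  -- Bumps of radius 1/3 at distinct integers have disjoint supports, so `φ` is locally a multiple
  -- of a single bump despite the jumps of `round`.
  have hloc : ∀ (k : ℤ) (x : ℝ), |x - k| < 2 / 3 → φ x = u k * ρ (x - k) := by
    intro k x hx
    by_cases hk : round x = k
    · simp [hφ, hk]
    · have h1 : |x - round x| ≤ |x - k| := round_le x k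
      have h2 : (1 : ℝ) ≤ |(round x : ℝ) - k| := by
        exact_mod_cast Int.one_le_abs (sub_ne_zero.2 hk)
      have h3 : |(round x : ℝ) - k| ≤ |(round x : ℝ) - x| + |x - k| := abs_sub_le _ _ _
      rw [abs_sub_comm (round x : ℝ) x] at h3
      simp only [hφ]
      rw [hzero _ (by linarith), hzero _ (by linarith), mul_zero, mul_zero]
  have hev : ∀ x : ℝ, φ =ᶠ[nhds x] fun y ↦ u (round x) * ρ (y - round x) := by
    intro x
    have : {y : ℝ | |y - round x| < 2 / 3} ∈ nhds x :=
      (isOpen_lt (by fun_prop) continuous_const).mem_nhds (by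
        have := abs_sub_round x
        simp only [Set.mem_ofPred_eq]; linarith)
    filter_upwards [this] with y hy using hloc _ _ hy
  have hsm : ∀ k : ℤ, ContDiff ℝ ∞ fun y : ℝ ↦ u k * ρ (y - k) := fun k ↦
    contDiff_const.mul (hρ.comp (contDiff_id.sub contDiff_const))
  have hcd : ContDiff ℝ ∞ φ := contDiff_iff_contDiffAt.2 fun x ↦
    (hsm (round x)).contDiffAt.congr_of_eventuallyEq (hev x)
  refine ⟨φ, hcd, fun x ↦ ?_, fun x y ↦ ?_, fun k ↦ ?_⟩
  · simp only [hφ]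
    rw [abs_mul, abs_of_nonneg ρ.nonneg]
    exact mul_le_of_le_one_right (abs_nonneg _) ρ.le_one |>.trans (hu _)
  · have hderiv : ∀ x, ‖deriv φ x‖ ≤ B * C := by
      intro x
      rw [(hev x).deriv_eq]
      refine norm_deriv_le_of_lip' (by positivity) (Eventually.of_forall fun y ↦ ?_)
      rw [← mul_sub, norm_mul, mul_assoc]
      refine mul_le_mul (hu _) ?_ (norm_nonneg _) hB
      have := hC (y - round x) (x - round x)
      rwa [sub_sub_sub_cancel_right] at this
    have := Convex.norm_image_sub_le_of_norm_deriv_le (f := φ) (s := Set.univ) (x := y) (y := x)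
      (fun z _ ↦ hcd.differentiable (by simp) z) (fun z _ ↦ hderiv z) convex_univ trivial trivial
    exact this
  · have : ρ 0 = 1 := ρ.one_of_mem_closedBall (by simp [ρ.rIn_pos.le])
    simp [hφ, this]

/-- A contractive perturbation of the identity is a homeomorphism. -/
theorem exists_homeomorph_id_add {P : ℂ → ℂ} (hP : ∀ z w, ‖P z - P w‖ ≤ 1 / 2 * ‖z - w‖) :
    ∃ S : ℂ ≃ₜ ℂ, ∀ z, S z = z + P z := by
  have h : ApproximatesLinearOn (fun z ↦ z + P z)
      ((ContinuousLinearEquiv.refl ℝ ℂ : ℂ ≃L[ℝ] ℂ) : ℂ →L[ℝ] ℂ) Set.univ (1 / 2) := by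
    intro z _ w _
    have : z + P z - (w + P w) - (z - w) = P z - P w := by ring
    simpa [this] using hP z w
  have hN : Subsingleton ℂ ∨ (1 / 2 : NNReal) <
      ‖((ContinuousLinearEquiv.refl ℝ ℂ).symm : ℂ →L[ℝ] ℂ)‖₊⁻¹ := by
    right
    have : ‖((ContinuousLinearEquiv.refl ℝ ℂ).symm : ℂ →L[ℝ] ℂ)‖₊ = 1 := by
      exact ContinuousLinearMap.nnnorm_id (𝕜 := ℝ) (E := ℂ)
    rw [this, inv_one]
    exact NNReal.half_lt_self one_ne_zero
  exact ⟨h.toHomeomorph _ hN, fun z ↦ rfl⟩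

/-- The horizontal shear `x + iy ↦ x + g(y) + iy`. -/
noncomputable def horizontalShear (g : ℝ → ℝ) (hg : Continuous g) : ℂ ≃ₜ ℂ where
  toFun z := z + g z.im
  invFun z := z - g z.im
  left_inv z := by simp
  right_inv z := by simp
  continuous_toFun := by fun_prop
  continuous_invFun := by fun_prop

/-- The vertical displacement field `φ(x) χ(y)`. -/
noncomputable def verticalField (φ χ : ℝ → ℝ) (z : ℂ) : ℂ := (φ z.re * χ z.im : ℝ) * Complex.I

theorem contDiff_verticalField {φ χ : ℝ → ℝ} (hφ : ContDiff ℝ ∞ φ) (hχ : ContDiff ℝ ∞ χ) :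
    ContDiff ℝ ∞ (verticalField φ χ) :=
  (Complex.ofRealCLM.contDiff.comp ((hφ.comp Complex.reCLM.contDiff).mul
    (hχ.comp Complex.imCLM.contDiff))).mul contDiff_const

/-- The bound `B` factors out of the Lipschitz constant, so scaling down the interpolated data makes
the field contractive. -/
theorem norm_verticalField_sub_le {φ χ : ℝ → ℝ} {B C X : ℝ} (hB : ∀ x, |φ x| ≤ B)
    (hφ : ∀ x y, |φ x - φ y| ≤ B * C * |x - y|) (hχ1 : ∀ y, |χ y| ≤ 1) (hX : 0 ≤ X) (hC : 0 ≤ C)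
    (hχ : ∀ x y, |χ x - χ y| ≤ X * |x - y|) (z w : ℂ) :
    ‖verticalField φ χ z - verticalField φ χ w‖ ≤ B * (C + X) * ‖z - w‖ := by
  have hB0 : 0 ≤ B := (abs_nonneg _).trans (hB 0)
  have hre : |z.re - w.re| ≤ ‖z - w‖ := Complex.abs_re_le_norm (z - w)
  have him : |z.im - w.im| ≤ ‖z - w‖ := Complex.abs_im_le_norm (z - w)
  have e : φ z.re * χ z.im - φ w.re * χ w.im =
      (φ z.re - φ w.re) * χ z.im + φ w.re * (χ z.im - χ w.im) := by ring
  rw [verticalField, verticalField, ← sub_mul, norm_mul, Complex.norm_I, mul_one,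
    ← Complex.ofReal_sub, Complex.norm_real, Real.norm_eq_abs, e]
  calc _ ≤ |φ z.re - φ w.re| * |χ z.im| + |φ w.re| * |χ z.im - χ w.im| := by
        rw [← abs_mul, ← abs_mul]; exact abs_add_le _ _
    _ ≤ (B * C * ‖z - w‖) * 1 + B * (X * ‖z - w‖) := by
        have h1 := (hφ z.re w.re).trans
          (mul_le_mul_of_nonneg_left hre (by positivity : 0 ≤ B * C))
        have h2 := (hχ z.im w.im).trans (mul_le_mul_of_nonneg_left him hX)
        exact add_le_add (mul_le_mul h1 (hχ1 _) (abs_nonneg _) (by positivity))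
          (mul_le_mul (hB _) h2 (abs_nonneg _) hB0)
    _ = _ := by ring

/-- Every permutation of the integers with bounded displacement extends to a quasiconformal map
that is the identity outside a prescribed horizontal strip. -/
theorem exists_isQuasiconformal_of_bounded_displacement (D δ : ℝ) (hD : 0 ≤ D) (hδ : 0 < δ)
    (hδ1 : δ ≤ 1) : ∃ K : ℝ, ∀ σ : ℤ ≃ ℤ, (∀ k, |(σ k : ℝ) - k| ≤ D) →
      ∃ f : ℂ ≃ₜ ℂ, IsQuasiconformal K f ∧ (∀ z : ℂ, δ ≤ |z.im| → f z = z) ∧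
        ∀ k : ℤ, f k = σ k := by
  obtain ⟨C, hC0, hC⟩ := exists_smooth_interpolation
  let χ : ContDiffBump (0 : ℝ) := ⟨δ / 2, δ, by positivity, by linarith⟩
  have hχ : ContDiff ℝ ∞ χ := χ.contDiff
  have hχ1 : ∀ y, |χ y| ≤ 1 := fun y ↦ by rw [abs_of_nonneg χ.nonneg]; exact χ.le_one
  have hχone : ∀ y, |y| ≤ δ / 2 → χ y = 1 := fun y hy ↦
    χ.one_of_mem_closedBall (by simpa [χ] using hy)
  have hχzero : ∀ y, δ ≤ |y| → χ y = 0 := fun y hy ↦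
    χ.zero_of_le_dist (by simpa [χ] using hy)
  have hχ0 : χ 0 = 1 := hχone 0 (by rw [abs_zero]; positivity)
  obtain ⟨X, hX0, hX⟩ := exists_lipschitz_const_of_hasCompactSupport hχ χ.hasCompactSupport
  -- The first bound makes the vertical fields 1/2-Lipschitz; the second keeps the lifted integers
  -- at heights where `χ = 1`.
  obtain ⟨ε, hε, hε1, hε2⟩ : ∃ ε : ℝ, 0 < ε ∧ ε * D * (C + X) ≤ 1 / 2 ∧ ε * D ≤ δ / 2 := by
    have hpos : 0 < D * (C + X) + D / δ + 1 := by positivity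
    refine ⟨1 / (2 * (D * (C + X) + D / δ + 1)), by positivity, ?_, ?_⟩
    · have : 0 ≤ D / δ := by positivity
      rw [mul_assoc, one_div_mul_eq_div, div_le_iff₀ (by positivity)]
      linarith
    · have h1 : D = D / δ * δ := by field_simp
      have h2 : 0 ≤ D * (C + X) := by positivity
      rw [one_div_mul_eq_div, div_le_iff₀ (by positivity)]
      nlinarith
  set g : ℝ → ℝ := fun y ↦ χ y * (y / ε) with hgdef
  have hg : ContDiff ℝ ∞ g := hχ.mul (contDiff_id.div_const _)
  obtain ⟨G, hG0, hG⟩ := exists_lipschitz_const_of_hasCompactSupport hg χ.hasCompactSupport.mul_right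
  -- The inverses of `S` and `R` are 2-Lipschitz and that of the shear is `(1 + G)`-Lipschitz. All
  -- constants are fixed before `σ`.
  refine ⟨(4 * (1 + G)) ^ 2, fun σ hσ ↦ ?_⟩
  obtain ⟨φ, hφs, hφb, hφl, hφ⟩ := hC (fun k ↦ ε * (σ k - k)) (ε * D) fun k ↦ by
    rw [abs_mul, abs_of_pos hε]; exact mul_le_mul_of_nonneg_left (hσ k) hε.le
  -- Indexed through `σ.symm` since the lowering acts at the target `σ k`, undoing the lift made at
  -- `k`.
  obtain ⟨ψ, hψs, hψb, hψl, hψ⟩ := hC (fun k ↦ -(ε * (k - σ.symm k))) (ε * D) fun k ↦ by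
    rw [abs_neg, abs_mul, abs_of_pos hε]
    have := hσ (σ.symm k)
    rw [σ.apply_symm_apply] at this
    exact mul_le_mul_of_nonneg_left this hε.le
  have hPφ : ∀ z w, ‖verticalField φ χ z - verticalField φ χ w‖ ≤ 1 / 2 * ‖z - w‖ := fun z w ↦
    (norm_verticalField_sub_le hφb hφl hχ1 hX0 hC0 hX z w).trans (by gcongr)
  have hPψ : ∀ z w, ‖verticalField ψ χ z - verticalField ψ χ w‖ ≤ 1 / 2 * ‖z - w‖ := fun z w ↦
    (norm_verticalField_sub_le hψb hψl hχ1 hX0 hC0 hX z w).trans (by gcongr)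
  obtain ⟨S, hS⟩ := exists_homeomorph_id_add hPφ
  obtain ⟨R, hR⟩ := exists_homeomorph_id_add hPψ
  set T := horizontalShear g hg.continuous with hTdef
  have hT : ∀ z, T z = z + g z.im := fun z ↦ rfl
  have hTim : ∀ z, (T z).im = z.im := fun z ↦ by simp [hT]
  have hgl : ∀ z w : ℂ, ‖(g z.im : ℂ) - g w.im‖ ≤ G * ‖z - w‖ := by
    intro z w
    rw [← Complex.ofReal_sub, Complex.norm_real]
    exact (hG _ _).trans (mul_le_mul_of_nonneg_left (Complex.abs_im_le_norm (z - w)) hG0)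
  have hTl : ∀ z w, ‖T z - T w‖ ≤ (1 + G) * ‖z - w‖ := by
    intro z w
    have e : T z - T w = (z - w) + (g z.im - g w.im) := by rw [hT, hT]; ring
    rw [e]
    exact (norm_add_le _ _).trans (by linarith [hgl z w])
  have hTe : ∀ z w, ‖z - w‖ ≤ (1 + G) * ‖T z - T w‖ := by
    intro z w
    have e : z - w = (T z - T w) - (g (T z).im - g (T w).im) := by
      rw [hTim, hTim, hT, hT]; ring
    have := hgl (T z) (T w)
    calc ‖z - w‖ = ‖(T z - T w) - (g (T z).im - g (T w).im)‖ := congr_arg _ e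
      _ ≤ ‖T z - T w‖ + ‖(g (T z).im : ℂ) - g (T w).im‖ := norm_sub_le _ _
      _ ≤ _ := by linarith
  have hlip : ∀ (S : ℂ ≃ₜ ℂ) (P : ℂ → ℂ), (∀ z, S z = z + P z) →
      (∀ z w, ‖P z - P w‖ ≤ 1 / 2 * ‖z - w‖) → ∀ z w,
      ‖S z - S w‖ ≤ 3 / 2 * ‖z - w‖ ∧ ‖z - w‖ ≤ 2 * ‖S z - S w‖ := by
    intro S P hS hP z w
    have e : S z - S w = (z - w) + (P z - P w) := by rw [hS, hS]; ring
    have e' : z - w = (S z - S w) - (P z - P w) := by rw [e]; ring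
    have h1 := norm_add_le (z - w) (P z - P w)
    have h2 := norm_sub_le (S z - S w) (P z - P w)
    rw [← e] at h1
    rw [← e'] at h2
    have := hP z w
    constructor <;> linarith
  refine ⟨(S.trans T).trans R, isQuasiconformal_of_biLipschitz _ ?_ (by linarith) ?_ ?_ ?_, ?_, ?_⟩
  · have hSc : ContDiff ℝ ∞ S := by
      rw [funext hS]; exact contDiff_id.add (contDiff_verticalField hφs hχ)
    have hRc : ContDiff ℝ ∞ R := by
      rw [funext hR]; exact contDiff_id.add (contDiff_verticalField hψs hχ)
    have hTc : ContDiff ℝ ∞ T := by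
      rw [funext hT]
      exact contDiff_id.add (Complex.ofRealCLM.contDiff.comp (hg.comp Complex.imCLM.contDiff))
    exact ((hRc.comp (hTc.comp hSc))).of_le (by simp)
  · intro y z
    have h1 := (hlip S _ hS hPφ y z).1
    have h2 := hTl (S y) (S z)
    have h3 := (hlip R _ hR hPψ (T (S y)) (T (S z))).1
    have h4 := mul_le_mul_of_nonneg_left h1 (by linarith : 0 ≤ 1 + G)
    have h5 : 0 ≤ (1 + G) * ‖y - z‖ := by positivity
    change ‖R (T (S y)) - R (T (S z))‖ ≤ _
    linarith
  · intro y z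
    have h1 := (hlip S _ hS hPφ y z).2
    have h2 := hTe (S y) (S z)
    have h3 := (hlip R _ hR hPψ (T (S y)) (T (S z))).2
    have h4 := mul_le_mul_of_nonneg_left h3 (by linarith : 0 ≤ 1 + G)
    change _ ≤ 4 * (1 + G) * ‖R (T (S y)) - R (T (S z))‖
    linarith
  all_goals
    have hid : ∀ z : ℂ, δ ≤ |z.im| → ((S.trans T).trans R) z = z := by
      intro z hz
      have h1 : S z = z := by simp [hS, verticalField, hχzero _ hz]
      have h2 : T z = z := by simp [hT, hgdef, hχzero _ hz]
      have h3 : R z = z := by simp [hR, verticalField, hχzero _ hz]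
      simp [h1, h2, h3]
  · exact fun z hz ↦ hid z (hδ1.trans (hz.trans (le_abs_self _)))
  · exact hid
  · intro k
    have hd : |ε * ((σ k : ℝ) - k)| ≤ δ / 2 := by
      rw [abs_mul, abs_of_pos hε]
      exact (mul_le_mul_of_nonneg_left (hσ k) hε.le).trans hε2
    obtain ⟨y, hy⟩ : ∃ y : ℝ, y = ε * ((σ k : ℝ) - k) := ⟨_, rfl⟩
    rw [← hy] at hd
    have h1 : S k = k + y * Complex.I := by
      simp [hS, verticalField, hφ, hχ0, hy]
    have h2 : T (k + y * Complex.I) = (σ k : ℝ) + y * Complex.I := by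
      have : g y = σ k - k := by
        simp only [hgdef, hχone y hd]; rw [hy]; field_simp
      rw [hT]
      simp [this]
      ring
    have h3 : R ((σ k : ℝ) + y * Complex.I) = σ k := by
      rw [hR]
      simp [verticalField, hψ, hχone y hd]
      rw [hy]; push_cast; ring
    change R (T (S k)) = _
    rw [h1, h2, h3]

/-! ### The main theorem -/

theorem theorem3p1 (lam : ℝ) (hlam : 1 ≤ lam) (δ : ℝ≥0∞) (hδ : 0 < δ) :
    ∃ K : ℝ, ∀ a : ℤ → ℤ, Function.Bijective a → ThreePointCondition lam a →
      Tendsto a atTop atTop → Tendsto a atBot atBot →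
      ∃ f : ℂ ≃ₜ ℂ, IsQuasiconformal K f ∧
        (∀ z : ℂ, ¬ (ENNReal.ofReal |z.im| < δ) → f z = z) ∧
        ∃ b : ℤ → ℤ, (∀ n, f (a n : ℂ) = (b n : ℂ)) ∧ IsSplittable (2 * lam + 3) b := by
  -- Capping at 1 covers `δ = ⊤` and makes `f` the identity on `1 ≤ Im`.
  set η : ℝ := (min δ 1).toReal with hη
  have hmin : min δ 1 ≠ ⊤ := ne_top_of_le_ne_top ENNReal.one_ne_top (min_le_right _ _)
  have hη0 : 0 < η := ENNReal.toReal_pos (lt_min hδ one_pos).ne' hmin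
  have hη1 : η ≤ 1 := by
    simpa using ENNReal.toReal_mono ENNReal.one_ne_top (min_le_right δ 1)
  obtain ⟨K, hK⟩ := exists_isQuasiconformal_of_bounded_displacement (2 * lam + 1) η
    (by linarith) hη0 hη1
  refine ⟨K, fun a hb ha htop hbot ↦ ?_⟩
  set e := Equiv.ofBijective a hb with he
  have happly : ∀ n, (e.symm.trans (Equiv.addRight (a 0))) (a n) = n + a 0 := by
    intro n
    have : e.symm (a n) = n := e.symm_apply_apply n
    simp [this]
  -- The displacement of `a n ↦ n + a 0` is the growth estimate between the indices `0` and `n`.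
  obtain ⟨f, hf, hid, hfk⟩ := hK (e.symm.trans (Equiv.addRight (a 0))) fun k ↦ by
    obtain ⟨n, rfl⟩ := hb.2 k
    rw [happly]
    push_cast
    rcases le_total 0 n with h | h
    · have := ha.abs_sub_sub_le hlam hb htop hbot h
      rw [← abs_neg]
      convert this using 2
      push_cast; ring
    · have := ha.abs_sub_sub_le hlam hb htop hbot h
      convert this using 2
      push_cast; ring
  refine ⟨f, hf, fun z hz ↦ hid z ?_, fun n ↦ n + a 0, fun n ↦ by rw [hfk, happly], ?_, fun n ↦ n,
    strictMono_id, fun n ↦ ⟨⟨le_rfl, ?_, ?_⟩, ?_⟩⟩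
  · rw [not_lt] at hz
    exact ENNReal.toReal_le_of_le_ofReal (abs_nonneg _) ((min_le_left _ _).trans hz)
  · exact (Equiv.addRight (a 0)).bijective
  · rintro m hm j ⟨-, hj⟩
    simp only; omega
  · rintro m hm j ⟨hj, -⟩
    simp only; omega
  · simp only [add_sub_cancel_left, Int.cast_one]
    linarith
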